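/- Let $\mathsf{Vars}$ be a finite set of variables, $\mathsf{States}=\mathsf{Vars}\to\mathbb N$, $\mathbf X=(X_v)_{v\in\mathsf{Vars}}$ indeterminates, and $\mathbf X^s=\prod_v X_v^{s(v)}$. ReDiP programs are given by $$P::= v:=n \mid v{-}{-} \mid v \mathrel{+}= \mathrm{iid}(D,y) \mid \mathrm{if}(v<n)\{P_1\}\,\mathrm{else}\,\{P_2\} \mid P_1;P_2 \mid \mathrm{while}(v<n)\{P_1\},$$ with $v,y\in\mathsf{Vars}$, $n\in\mathbb N$ and $D$ a probability distribution on $\mathbb N$; put $⟦D⟧=\sum_k D(k)T^k$. The generating function of a measure $\mu$ on $\mathsf{States}$ is $g_\mu=\sum_s\mu(\{s\})\mathbf X^s\in\mathbb R_{\ge0}^\infty[[\mathbf X]]$. Operations on power series (coefficients in $\mathbb R_{\ge 0}^\infty$ or in $\mathbb R$): substitution $g[X_v/h]$, whose coefficient at $s$ is $\sum_{s_1+s_2=s,\ s_2(v)=s(v)}\sum_{k\in\mathbb N}[g]_{s_1[v\mapsto k]}\,[h^k]_{s_2}$; the downward shift $g\cdot X_v^{-1}$, whose coefficient at $s$ is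 $[g]_{s[v\mapsto s(v)+1]}$; and restriction $g_{v<n}=\sum_{i<n}\frac1{i!}(\partial^i_{X_v}g)[X_v/0]\cdot X_v^i$. Over $\mathbb R_{\ge0}^\infty$, $g-g_{v<n}$ denotes the series whose coefficient at $s$ is $[g]_s$ if $[g]_s\ne[g_{v<n}]_s$, and $0$ otherwise; over $\mathbb R$ it is ordinary subtraction. All orders are coefficientwise. The semantics $\mathrm{pm}⟦P⟧:\mathbb R_{\ge0}^\infty[[\mathbf X]]\to\mathbb R_{\ge0}^\infty[[\mathbf X]]$ is - $\mathrm{pm}⟦v:=n⟧(g)=g[X_v/1]\cdot X_v^n$; - $\mathrm{pm}⟦v{-}{-}⟧(g)=(g-g_{v<1})\cdot X_v^{-1}+g_{v<1}$; - $\mathrm{pm}⟦v\mathrel{+}=\mathrm{iid}(D,y)⟧(g)=g[X_y/X_y\cdot⟦D⟧[T/X_v]]$; - $\mathrm{pm}⟦\mathrm{if}(v<n)\{P_1\}\mathrm{else}\{P_2\}⟧(g)=\mathrm{pm}⟦P_1⟧(g_{v<n})+\mathrm{pm}⟦P_2⟧(g-g_{v<n})$; - $\mathrm{pm}⟦P_1;P_2⟧(g)=\mathrm{pm}⟦P_2⟧(\mathrm{pm}⟦P_1⟧(g))$;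 - $\mathrm{pm}⟦\mathrm{while}(v<n)\{P_1\}⟧(g)=h-h_{v<n}$, where $h$ is the least fixed point of $i\mapsto g+\mathrm{pm}⟦P_1⟧(i_{v<n})$. Let $\mathrm{PGF}$ be the set of $G\in\mathbb R[[\mathbf X]]$ with nonnegative coefficients whose sum is at most $1$. The semantics $⟦P⟧$ of Chen et al. on $\mathrm{PGF}$ is given, with the operations of $\mathbb R[[\mathbf X]]$, by the same clauses (in the decrement clause with $G[X_v/0]$ in place of $G_{v<1}$), except that $⟦\mathrm{while}(v<n)\{P_1\}⟧$ is the least fixed point, among functions $\mathrm{PGF}\to\mathrm{PGF}$ ordered pointwise, of $$\Phi(T)=\lambda G.\ (G-G_{v<n})+T(⟦P_1⟧(G_{v<n})).$$ **Proposition.** For every sub-probability distribution $\mu$ on $\mathsf{States}$ and every ReDiP program $P$: $g_\mu\in\mathbb R_{\ge0}[[\mathbf X]]$ (all coefficients are finite), $g_\mu$ is in $\mathrm{PGF}$, $⟦P⟧(g_\mu)\in\mathrm{PGF}$ is well defined (all intermediate results lie in $\mathrm{PGF}$ and all least fixed points involved exist), and $$\mathrm{pm}⟦P⟧(g_\mu)=⟦P⟧(g_\mu).$$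 -/

import Mathlib

open scoped ENNReal NNReal

/-- Rectangular discrete probabilistic programs over the variables `V`. -/
inductive ReDiP (V : Type*) where
  /-- `v := n` -/
  | assign (v : V) (n : ℕ)
  /-- `v--` (truncated at `0`) -/
  | decr (v : V)
  /-- `v += iid(D, y)`: add to `v` the sum of `y` independent samples of `D` -/
  | incr (v : V) (D : PMF ℕ) (y : V)
  /-- `if (v < n) {P₁} else {P₂}` -/
  | ite (v : V) (n : ℕ) (P₁ P₂ : ReDiP V)
  /-- `P₁; P₂` -/
  | seq (P₁ P₂ : ReDiP V)
  /-- `while (v < n) {P}` -/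
  | loop (v : V) (n : ℕ) (P : ReDiP V)

namespace ReDiP

section Operations

/-! Operations on formal power series, for coefficients in `ℝ≥0∞` and in `ℝ` alike. -/

variable {V : Type*} [DecidableEq V] {R : Type*} [CommSemiring R]

/-- Substitution `g[X_v / h]`. The coefficient of `X^s` is
`∑_{s₁ + s₂ = s, s₂(v) = s(v)} ∑_k [g]_{s₁[v ↦ k]} * [h^k]_{s₂}`. -/
noncomputable def subst [TopologicalSpace R] (v : V) (h g : MvPowerSeries V R) :
    MvPowerSeries V R := fun s =>
  ∑ p ∈ (Finset.HasAntidiagonal.antidiagonal s).filter (fun p => p.2 v = s v),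
    ∑' k : ℕ, MvPowerSeries.coeff (p.1.update v k) g * MvPowerSeries.coeff p.2 (h ^ k)

/-- Downward shift `g * X_v⁻¹`, used only when `g` has no terms without `X_v`. -/
noncomputable def shift (v : V) (g : MvPowerSeries V R) : MvPowerSeries V R := fun s =>
  MvPowerSeries.coeff (s.update v (s v + 1)) g

/-- Restriction `g_{v < n} = ∑_{i < n} (1 / i!) (∂_{X_v}^i g)[X_v / 0] * X_v^i`. -/
noncomputable def restrict [TopologicalSpace R] [Inv R] (v : V) (n : ℕ) (g : MvPowerSeries V R) :
    MvPowerSeries V R :=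
  ∑ i ∈ Finset.range n, MvPowerSeries.C ((i.factorial : R)⁻¹) *
    subst v 0 ((MvPowerSeries.pderiv R v)^[i] g) * MvPowerSeries.X v ^ i

/-- `⟦D⟧[T / X_v]` for a univariate series `⟦D⟧` in the variable `T`. -/
noncomputable def inVar (v : V) (d : PowerSeries R) : MvPowerSeries V R :=
  MvPowerSeries.rename (fun _ : Unit => v) d

end Operations

section PM

/-! The occupation-measure semantics on power series with coefficients in `ℝ≥0∞`. -/

variable {V : Type*}

/-- Power series with coefficients in `ℝ≥0∞` are ordered coefficientwise. -/
noncomputable instance : CompleteLattice (MvPowerSeries V ℝ≥0∞) :=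
  inferInstanceAs (CompleteLattice ((V →₀ ℕ) → ℝ≥0∞))

/-- The generating function of a measure on the set `V → ℕ` of program states. -/
noncomputable def gf (μ : MeasureTheory.Measure (V → ℕ)) : MvPowerSeries V ℝ≥0∞ := fun s => μ {⇑s}

/-- The generating function `⟦D⟧` with coefficients in `ℝ≥0∞`. -/
noncomputable def pmfSeries (D : PMF ℕ) : PowerSeries ℝ≥0∞ := PowerSeries.mk fun k => D k

theorem le_iff_coeff {g h : MvPowerSeries V ℝ≥0∞} :
    g ≤ h ↔ ∀ s, MvPowerSeries.coeff s g ≤ MvPowerSeries.coeff s h := Iff.rfl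

theorem add_mono {a b c d : MvPowerSeries V ℝ≥0∞} (h : a ≤ b) (h' : c ≤ d) : a + c ≤ b + d :=
  le_iff_coeff.2 fun s => by
    simpa only [map_add] using add_le_add (le_iff_coeff.1 h s) (le_iff_coeff.1 h' s)

theorem mul_mono {a b c d : MvPowerSeries V ℝ≥0∞} (h : a ≤ b) (h' : c ≤ d) : a * c ≤ b * d := by
  classical
  refine le_iff_coeff.2 fun s => ?_
  rw [MvPowerSeries.coeff_mul, MvPowerSeries.coeff_mul]
  exact Finset.sum_le_sum fun p _ =>
    mul_le_mul' (le_iff_coeff.1 h p.1) (le_iff_coeff.1 h' p.2)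

theorem shift_mono (v : V) {g g' : MvPowerSeries V ℝ≥0∞} (h : g ≤ g') : shift v g ≤ shift v g' :=
  fun _ => h _

theorem pderiv_iterate_mono (v : V) (i : ℕ) {g g' : MvPowerSeries V ℝ≥0∞} (h : g ≤ g') :
    (MvPowerSeries.pderiv ℝ≥0∞ v)^[i] g ≤ (MvPowerSeries.pderiv ℝ≥0∞ v)^[i] g' := by
  refine Monotone.iterate (f := MvPowerSeries.pderiv ℝ≥0∞ v) (fun a b hab => ?_) i h
  refine le_iff_coeff.2 fun s => ?_
  rw [MvPowerSeries.coeff_pderiv, MvPowerSeries.coeff_pderiv]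
  gcongr
  exact le_iff_coeff.1 hab _

theorem coeff_pderiv_iterate (v : V) (i : ℕ) (g : MvPowerSeries V ℝ≥0∞) (s : V →₀ ℕ)
    (hs : s v = 0) : MvPowerSeries.coeff s ((MvPowerSeries.pderiv ℝ≥0∞ v)^[i] g) =
      MvPowerSeries.coeff (s + Finsupp.single v i) g * (i.factorial : ℝ≥0∞) := by
  suffices H : ∀ (i : ℕ) (g : MvPowerSeries V ℝ≥0∞),
      MvPowerSeries.coeff s ((MvPowerSeries.pderiv ℝ≥0∞ v)^[i] g) =
      MvPowerSeries.coeff (s + Finsupp.single v i) g * (i.factorial : ℝ≥0∞) from H i g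
  intro i
  induction i with
  | zero => intro g; simp
  | succ i ih =>
    intro g
    rw [Function.iterate_succ_apply, ih, MvPowerSeries.coeff_pderiv, add_assoc,
      ← Finsupp.single_add, Nat.factorial_succ]
    simp only [Finsupp.add_apply, hs, Finsupp.single_eq_same, zero_add]
    push_cast
    ring

variable [DecidableEq V]

open Classical in
/-- The series written `g - g_{v < n}`: the coefficients of `g` that differ from those of
`g_{v < n}`. -/
noncomputable def restrictCompl (v : V) (n : ℕ) (g : MvPowerSeries V ℝ≥0∞) :
    MvPowerSeries V ℝ≥0∞ := fun s =>
  if MvPowerSeries.coeff s g ≠ MvPowerSeries.coeff s (restrict v n g)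
    then MvPowerSeries.coeff s g else 0

theorem subst_mono (v : V) (h : MvPowerSeries V ℝ≥0∞) {g g' : MvPowerSeries V ℝ≥0∞}
    (hg : g ≤ g') : subst v h g ≤ subst v h g' := fun _ =>
  Finset.sum_le_sum fun _ _ => ENNReal.tsum_le_tsum fun _ =>
    mul_le_mul' (le_iff_coeff.1 hg _) le_rfl

theorem restrict_mono (v : V) (n : ℕ) {g g' : MvPowerSeries V ℝ≥0∞} (h : g ≤ g') :
    restrict v n g ≤ restrict v n g' := by
  refine le_iff_coeff.2 fun s => ?_
  rw [restrict, restrict, map_sum, map_sum]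
  exact Finset.sum_le_sum fun i _ => le_iff_coeff.1
    (mul_mono (mul_mono le_rfl (subst_mono v 0 (pderiv_iterate_mono v i h))) le_rfl) s

theorem coeff_subst_zero (v : V) (g : MvPowerSeries V ℝ≥0∞) (s : V →₀ ℕ) :
    MvPowerSeries.coeff s (subst v 0 g) = if s v = 0 then MvPowerSeries.coeff s g else 0 := by
  have key : ∀ p : (V →₀ ℕ) × (V →₀ ℕ),
      ∑' k : ℕ, MvPowerSeries.coeff (p.1.update v k) g * MvPowerSeries.coeff p.2
        ((0 : MvPowerSeries V ℝ≥0∞) ^ k) =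
      if p.2 = 0 then MvPowerSeries.coeff (p.1.update v 0) g else 0 := by
    intro p
    rw [tsum_eq_single 0]
    · simp [MvPowerSeries.coeff_one]
    · intro k hk
      simp [hk]
  change ∑ p ∈ _, _ = _
  rw [Finset.sum_congr rfl fun p _ => key p]
  split_ifs with h
  · rw [Finset.sum_eq_single (s, 0)]
    · have : s.update v 0 = s := by rw [← h, Finsupp.update_self]
      simp [this]
    · rintro ⟨a, b⟩ hp hne
      simp only [Finset.mem_filter, Finset.HasAntidiagonal.mem_antidiagonal] at hp
      rw [if_neg]
      rintro rfl
      exact hne (by simpa using hp.1)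
    · intro hn
      simp [h] at hn
  · refine Finset.sum_eq_zero fun p hp => if_neg fun h0 => h ?_
    rw [← (Finset.mem_filter.1 hp).2, h0]
    rfl

/-- Restriction keeps exactly the coefficients of the states with `s v < n`. -/
theorem coeff_restrict (v : V) (n : ℕ) (g : MvPowerSeries V ℝ≥0∞) (s : V →₀ ℕ) :
    MvPowerSeries.coeff s (restrict v n g) = if s v < n then MvPowerSeries.coeff s g else 0 := by
  have key : ∀ i : ℕ, MvPowerSeries.coeff s (MvPowerSeries.C ((i.factorial : ℝ≥0∞)⁻¹) *
      subst v 0 ((MvPowerSeries.pderiv ℝ≥0∞ v)^[i] g) * MvPowerSeries.X v ^ i) =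
      if i = s v then MvPowerSeries.coeff s g else 0 := by
    intro i
    rw [MvPowerSeries.X_pow_eq, MvPowerSeries.coeff_mul_monomial, mul_one]
    by_cases h : Finsupp.single v i ≤ s
    · rw [if_pos h, MvPowerSeries.coeff_C_mul, coeff_subst_zero]
      have hi : i ≤ s v := by simpa using h v
      have hv : (s - Finsupp.single v i) v = s v - i := by simp
      rw [hv]
      by_cases h2 : i = s v
      · rw [if_pos h2, if_pos (by omega), coeff_pderiv_iterate _ _ _ _ (by rw [hv]; omega),
          tsub_add_cancel_of_le h, mul_comm, mul_assoc, ENNReal.mul_inv_cancel, mul_one]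
        · exact_mod_cast i.factorial_ne_zero
        · exact ENNReal.natCast_ne_top _
      · rw [if_neg h2, if_neg (by omega), mul_zero]
    · rw [if_neg h, if_neg]
      rintro rfl
      exact h (by simp)
  rw [restrict, map_sum, Finset.sum_congr rfl fun i _ => key i, Finset.sum_ite_eq']
  simp

theorem coeff_restrictCompl (v : V) (n : ℕ) (g : MvPowerSeries V ℝ≥0∞) (s : V →₀ ℕ) :
    MvPowerSeries.coeff s (restrictCompl v n g) =
      if s v < n then 0 else MvPowerSeries.coeff s g := by
  change (if _ then _ else _) = _
  rw [coeff_restrict]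
  split_ifs <;> simp_all

theorem restrictCompl_mono (v : V) (n : ℕ) {g g' : MvPowerSeries V ℝ≥0∞} (h : g ≤ g') :
    restrictCompl v n g ≤ restrictCompl v n g' := by
  refine le_iff_coeff.2 fun s => ?_
  rw [coeff_restrictCompl, coeff_restrictCompl]
  split_ifs
  · exact le_rfl
  · exact le_iff_coeff.1 h s

/-- The generating-function semantics `pm⟦P⟧`, a monotone map on `ℝ≥0∞[[X]]`. In the loop case
`OrderHom.lfp` is the least fixed point of `i ↦ g + pm⟦P⟧(i_{v < n})`. -/
noncomputable def pm : ReDiP V → (MvPowerSeries V ℝ≥0∞ →o MvPowerSeries V ℝ≥0∞)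
  | assign v n =>
    ⟨fun g => subst v 1 g * MvPowerSeries.X v ^ n,
      fun _ _ h => mul_mono (subst_mono v 1 h) le_rfl⟩
  | decr v =>
    ⟨fun g => shift v (restrictCompl v 1 g) + restrict v 1 g,
      fun _ _ h => add_mono (shift_mono v (restrictCompl_mono v 1 h)) (restrict_mono v 1 h)⟩
  | incr v D y =>
    ⟨fun g => subst y (MvPowerSeries.X y * inVar v (pmfSeries D)) g,
      fun _ _ h => subst_mono y _ h⟩
  | ite v n P₁ P₂ =>
    ⟨fun g => pm P₁ (restrict v n g) + pm P₂ (restrictCompl v n g),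
      fun _ _ h => add_mono ((pm P₁).monotone (restrict_mono v n h))
        ((pm P₂).monotone (restrictCompl_mono v n h))⟩
  | seq P₁ P₂ => ⟨fun g => pm P₂ (pm P₁ g), fun _ _ h => (pm P₂).monotone ((pm P₁).monotone h)⟩
  | loop v n P =>
    ⟨fun g => restrictCompl v n (OrderHom.lfp
        ⟨fun i => g + pm P (restrict v n i),
          fun _ _ h => add_mono le_rfl ((pm P).monotone (restrict_mono v n h))⟩),
      fun _ _ h => restrictCompl_mono v n (OrderHom.lfp.monotone fun _ => add_mono h le_rfl)⟩

end PM

section Chen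

/-! The semantics of Chen, Katoen, Klinkenberg and Winkler on (sub-)probability generating
functions, with the operations of the ring `ℝ[[X]]`. -/

variable {V : Type*}

/-- (Sub-)probability generating functions: nonnegative real coefficients, total mass `≤ 1`. -/
def IsPGF (g : MvPowerSeries V ℝ) : Prop :=
  (∀ s, 0 ≤ MvPowerSeries.coeff s g) ∧ (Summable fun s => MvPowerSeries.coeff s g) ∧
    ∑' s, MvPowerSeries.coeff s g ≤ 1

/-- The type of (sub-)probability generating functions. -/
def PGF (V : Type*) : Type _ := {g : MvPowerSeries V ℝ // IsPGF g}

/-- PGFs are ordered coefficientwise; functions `PGF V → PGF V` then carry the pointwise order. -/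
noncomputable instance : PartialOrder (PGF V) :=
  PartialOrder.lift (fun (G : PGF V) (s : V →₀ ℕ) => MvPowerSeries.coeff s G.1)
    fun _ _ h => Subtype.ext (MvPowerSeries.ext fun s => congrFun h s)

/-- A series of `ℝ[[X]]` as a PGF; undefined if it is not one. -/
def toPGF (g : MvPowerSeries V ℝ) : Part (PGF V) := ⟨IsPGF g, fun h => ⟨g, h⟩⟩

/-- The generating function `⟦D⟧` with coefficients in `ℝ`. -/
noncomputable def pmfSeriesReal (D : PMF ℕ) : PowerSeries ℝ := PowerSeries.mk fun k => (D k).toReal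

variable [DecidableEq V]

/-- The unfolding operator `Φ(T) = λ G. (G - G_{v < n}) + T(F(G_{v < n}))` of a loop with guard
`v < n` whose body has the semantics `F`. -/
noncomputable def unfolding (v : V) (n : ℕ) (F : PGF V → Part (PGF V)) (T : PGF V → PGF V)
    (G : PGF V) : Part (PGF V) := do
  let A ← toPGF (restrict v n G.1)
  let B ← F A
  toPGF ((G.1 - restrict v n G.1) + (T B).1)

/-- `T : PGF V → PGF V` is the least fixed point of the unfolding operator. -/
def IsLoopLfp (v : V) (n : ℕ) (F : PGF V → Part (PGF V)) (T : PGF V → PGF V) : Prop :=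
  IsLeast {T : PGF V → PGF V | ∀ G, unfolding v n F T G = Part.some (T G)} T

/-- The semantics `⟦P⟧ : PGF → PGF` of Chen et al., a priori partial: `chen P G` is defined iff all
intermediate results are PGFs and all least fixed points involved exist. -/
noncomputable def chen : ReDiP V → PGF V → Part (PGF V)
  | assign v n, G => toPGF (subst v 1 G.1 * MvPowerSeries.X v ^ n)
  | decr v, G => toPGF (shift v (G.1 - subst v 0 G.1) + subst v 0 G.1)
  | incr v D y, G => toPGF (subst y (MvPowerSeries.X y * inVar v (pmfSeriesReal D)) G.1)
  | ite v n P₁ P₂, G => do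
    let A ← toPGF (restrict v n G.1)
    let B ← toPGF (G.1 - restrict v n G.1)
    let A' ← chen P₁ A
    let B' ← chen P₂ B
    toPGF (A'.1 + B'.1)
  | seq P₁ P₂, G => do
    let H ← chen P₁ G
    chen P₂ H
  | loop v n P, G => ⟨∃ T, IsLoopLfp v n (chen P) T, fun h => h.choose G⟩

end Chen

end ReDiP

/-!
Both semantics are run on the side of `ℝ≥0∞`-coefficients, where sums need no convergence
hypotheses, and the real semantics is read off by taking `ENNReal.toReal` coefficientwise.

Two properties of `pm⟦P⟧`, proved by induction on `P`, carry the argument: it commutes with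
arbitrary coefficientwise sums (`isSigmaAdditive_pm`), and it does not increase the total mass
(`mass_pm_le`). By additivity, the least solution of `i = g + pm⟦P⟧(i_{v < n})` is the geometric sum
`∑ₖ Kᵏ g`, where `K` is one guarded pass through the body (`IsSigmaAdditive.lfp_eq`). A loop
therefore maps `g` to the sum over `k` of what leaves it after exactly `k` passes (`pm_loop`). The
mass bound for loops is a telescoping estimate: what has left within `N` passes, together with what
is still inside, never exceeds the mass at the start.

On series of mass at most `1` all coefficients are finite, so the power series operations commute
with `toReal`, and `pm⟦P⟧` induces a map `pmPGF P` on PGFs. That this map is the semantics of Chen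
et al. is clear for all constructs but loops. There it is a fixed point of `Φ`, by splitting off the
term `k = 0` (`pm_loop_unroll`). It is the least one, because every fixed point `T` satisfies
`T(G) = (G - G_{v < n}) + T(K G)`, hence dominates the partial sums of `pm_loop` by induction on
their length (`isLoopLfp_pmPGF`).
-/

namespace ReDiP

open MvPowerSeries

variable {V : Type*}

/-! ### Total mass -/

/-- The total mass of a series: the sum of all its coefficients. -/
noncomputable def mass (g : MvPowerSeries V ℝ≥0∞) : ℝ≥0∞ := ∑' s, coeff s g

theorem coeff_le_mass (g : MvPowerSeries V ℝ≥0∞) (s : V →₀ ℕ) : coeff s g ≤ mass g :=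
  ENNReal.le_tsum s

theorem coeff_ne_top {g : MvPowerSeries V ℝ≥0∞} (hg : mass g ≤ 1) (s : V →₀ ℕ) :
    coeff s g ≠ ∞ :=
  ((coeff_le_mass g s).trans_lt (hg.trans_lt ENNReal.one_lt_top)).ne

theorem mass_add (g g' : MvPowerSeries V ℝ≥0∞) : mass (g + g') = mass g + mass g' := by
  simp only [mass, map_add, ENNReal.tsum_add]

theorem mass_monomial (s : V →₀ ℕ) (a : ℝ≥0∞) : mass (monomial s a) = a := by
  classical
  simp only [mass, coeff_monomial, tsum_ite_eq]

theorem tsum_sum_antidiagonal [DecidableEq V] (F : (V →₀ ℕ) × (V →₀ ℕ) → ℝ≥0∞) :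
    ∑' s, ∑ p ∈ Finset.HasAntidiagonal.antidiagonal s, F p = ∑' a, ∑' b, F (a, b) := by
  rw [← ENNReal.tsum_prod', ← Finset.HasAntidiagonal.sigmaAntidiagonalEquivProd.tsum_eq F,
    ENNReal.tsum_sigma']
  exact tsum_congr fun s => (Finset.tsum_subtype (Finset.HasAntidiagonal.antidiagonal s) F).symm

theorem mass_mul (g h : MvPowerSeries V ℝ≥0∞) : mass (g * h) = mass g * mass h := by
  classical
  simp only [mass, coeff_mul]
  rw [tsum_sum_antidiagonal fun p => coeff p.1 g * coeff p.2 h]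
  simp only [ENNReal.tsum_mul_left, ENNReal.tsum_mul_right]

theorem mass_one : mass (1 : MvPowerSeries V ℝ≥0∞) = 1 := mass_monomial 0 1

theorem mass_pow (g : MvPowerSeries V ℝ≥0∞) (k : ℕ) : mass (g ^ k) = mass g ^ k := by
  induction k with
  | zero => simp [mass_one]
  | succ k ih => rw [pow_succ, pow_succ, mass_mul, ih]

theorem mass_X (v : V) : mass (X v : MvPowerSeries V ℝ≥0∞) = 1 := mass_monomial _ 1

theorem coeff_inVar {R : Type*} [CommSemiring R] [DecidableEq V] (v : V)
    (d : PowerSeries R) (s : V →₀ ℕ) :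
    coeff s (inVar v d) = if Finsupp.single v (s v) = s then PowerSeries.coeff (s v) d else 0 := by
  have hmap : ∀ t : Unit →₀ ℕ,
      t.mapDomain (fun _ : Unit => v) = Finsupp.single v (t ()) := fun t => by
    have ht : t = Finsupp.single () (t ()) := by ext; simp
    conv_lhs => rw [ht, Finsupp.mapDomain_single]
  split_ifs with h
  · rw [inVar, coeff_rename, Finset.sum_eq_single (Finsupp.single () (s v))]
    · rfl
    · intro t ht hne
      refine absurd ?_ hne
      have ht' : t.mapDomain (fun _ : Unit => v) = s := by simpa using ht
      ext
      simp [← ht', hmap]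
    · intro hn
      simp [h] at hn
  · rw [inVar]
    refine coeff_rename_eq_zero _ _ ?_
    rintro ⟨t, rfl⟩
    exact h (by rw [hmap]; simp)

theorem mass_inVar_pmfSeries (v : V) (D : PMF ℕ) :
    mass (inVar v (pmfSeries D)) = 1 := by
  classical
  rw [mass, ← D.tsum_coe, ← (Finsupp.single_injective (M := ℕ) v).tsum_eq]
  · refine tsum_congr fun k => ?_
    simp [coeff_inVar, pmfSeries]
  · intro s hs
    rw [Function.mem_support, coeff_inVar] at hs
    exact ⟨s v, by_contra fun h => hs (if_neg h)⟩

theorem mass_shift_le (v : V) (g : MvPowerSeries V ℝ≥0∞) :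
    mass (shift v g) ≤ mass g := by
  classical
  refine ENNReal.tsum_comp_le_tsum_of_injective (f := fun s : V →₀ ℕ => s.update v (s v + 1))
    (fun s t h => ?_) (fun s => coeff s g)
  ext w
  have hw := DFunLike.congr_fun h w
  by_cases hwv : w = v
  · subst hwv
    simpa using hw
  · simpa [Finsupp.update_apply, hwv] using hw

section

variable [DecidableEq V]

theorem restrict_add_restrictCompl (v : V) (n : ℕ) (g : MvPowerSeries V ℝ≥0∞) :
    restrict v n g + restrictCompl v n g = g := by
  ext s
  rw [map_add, coeff_restrict, coeff_restrictCompl]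
  split_ifs <;> simp

theorem mass_restrict_add_mass_restrictCompl (v : V) (n : ℕ) (g : MvPowerSeries V ℝ≥0∞) :
    mass (restrict v n g) + mass (restrictCompl v n g) = mass g := by
  rw [← mass_add, restrict_add_restrictCompl]

theorem mass_restrict_le (v : V) (n : ℕ) (g : MvPowerSeries V ℝ≥0∞) :
    mass (restrict v n g) ≤ mass g :=
  le_self_add.trans_eq (mass_restrict_add_mass_restrictCompl v n g)

theorem mass_restrictCompl_le (v : V) (n : ℕ) (g : MvPowerSeries V ℝ≥0∞) :
    mass (restrictCompl v n g) ≤ mass g :=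
  le_add_self.trans_eq (mass_restrict_add_mass_restrictCompl v n g)

/-- In a coefficient `∑_{s₁ + s₂ = s, s₂(v) = s(v)} ∑ₖ [g]_{s₁[v ↦ k]} * [hᵏ]_{s₂}` the side condition
says `s₁(v) = 0`. Summing over `s` thus decouples `s₁` and `s₂`; the factor `[hᵏ]_{s₂}` adds up to
at most `1`, and each state has the form `s₁[v ↦ k]` exactly once. -/
theorem mass_subst_le (v : V) {h : MvPowerSeries V ℝ≥0∞} (hh : mass h ≤ 1)
    (g : MvPowerSeries V ℝ≥0∞) : mass (subst v h g) ≤ mass g := by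
  have hinj : Function.Injective
      fun p : {a : V →₀ ℕ // a v = 0} × ℕ => p.1.1.update v p.2 := by
    rintro ⟨⟨a, ha⟩, k⟩ ⟨⟨b, hb⟩, l⟩ hab
    have hkl : k = l := by simpa using DFunLike.congr_fun hab v
    have hab' : a = b := by
      ext w
      have hw := DFunLike.congr_fun hab w
      by_cases hwv : w = v
      · rw [hwv, ha, hb]
      · simpa [Finsupp.update_apply, hwv] using hw
    simp [hkl, hab']
  calc mass (subst v h g)
      = ∑' s, ∑ p ∈ Finset.HasAntidiagonal.antidiagonal s, {a : V →₀ ℕ | a v = 0}.indicator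
          (fun a => ∑' k : ℕ, coeff (a.update v k) g * coeff p.2 (h ^ k)) p.1 := by
        refine tsum_congr fun s => (Finset.sum_filter _ _).trans ?_
        refine Finset.sum_congr rfl fun p hp => ?_
        have hs : p.1 v + p.2 v = s v :=
          DFunLike.congr_fun (Finset.HasAntidiagonal.mem_antidiagonal.1 hp) v
        rw [Set.indicator_apply]
        exact if_congr (by simp only [Set.mem_ofPred_eq]; omega) rfl rfl
    _ = ∑' a, {a : V →₀ ℕ | a v = 0}.indicator
          (fun a => ∑' k : ℕ, coeff (a.update v k) g * mass (h ^ k)) a := by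
        rw [tsum_sum_antidiagonal fun p => {a : V →₀ ℕ | a v = 0}.indicator
          (fun a => ∑' k : ℕ, coeff (a.update v k) g * coeff p.2 (h ^ k)) p.1]
        refine tsum_congr fun a => ?_
        by_cases ha : a ∈ {a : V →₀ ℕ | a v = 0}
        · simp only [Set.indicator_of_mem ha]
          rw [ENNReal.tsum_comm]
          simp only [ENNReal.tsum_mul_left, mass]
        · simp only [Set.indicator_of_notMem ha, tsum_zero]
    _ ≤ ∑' a, {a : V →₀ ℕ | a v = 0}.indicator
          (fun a => ∑' k : ℕ, coeff (a.update v k) g) a := by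
        refine ENNReal.tsum_le_tsum fun a => Set.indicator_le_indicator ?_
        refine ENNReal.tsum_le_tsum fun k => mul_le_of_le_one_right' ?_
        rw [mass_pow]
        exact pow_le_one₀ zero_le hh
    _ = ∑' p : {a : V →₀ ℕ // a v = 0} × ℕ, coeff (p.1.1.update v p.2) g := by
        rw [ENNReal.tsum_prod']
        exact (tsum_subtype {a : V →₀ ℕ | a v = 0} _).symm
    _ ≤ mass g := ENNReal.tsum_comp_le_tsum_of_injective hinj fun s => coeff s g

end

/-! ### Countable additivity -/

/-- The coefficientwise sum of a family of series. -/
noncomputable def series {ι : Type*} (f : ι → MvPowerSeries V ℝ≥0∞) : MvPowerSeries V ℝ≥0∞ :=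
  fun s => ∑' i, coeff s (f i)

theorem coeff_series {ι : Type*} (f : ι → MvPowerSeries V ℝ≥0∞) (s : V →₀ ℕ) :
    coeff s (series f) = ∑' i, coeff s (f i) := rfl

theorem mass_series {ι : Type*} (f : ι → MvPowerSeries V ℝ≥0∞) :
    mass (series f) = ∑' i, mass (f i) := by
  simp only [mass, coeff_series]
  exact ENNReal.tsum_comm

theorem series_nat (f : ℕ → MvPowerSeries V ℝ≥0∞) :
    series f = f 0 + series fun k => f (k + 1) := by
  ext s
  simp only [map_add, coeff_series]
  exact tsum_eq_zero_add' ENNReal.summable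

/-- A map on series that commutes with coefficientwise sums of arbitrary families. The index types
in `Type` include `ℕ`, `Bool` and `Empty`, so this covers countable sums, binary sums and zero. -/
def IsSigmaAdditive (F : MvPowerSeries V ℝ≥0∞ → MvPowerSeries V ℝ≥0∞) : Prop :=
  ∀ (ι : Type) (f : ι → MvPowerSeries V ℝ≥0∞), F (series f) = series fun i => F (f i)

namespace IsSigmaAdditive

variable {F F' : MvPowerSeries V ℝ≥0∞ → MvPowerSeries V ℝ≥0∞}

theorem map_add (hF : IsSigmaAdditive F) (g g' : MvPowerSeries V ℝ≥0∞) :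
    F (g + g') = F g + F g' := by
  have h : ∀ a b : MvPowerSeries V ℝ≥0∞, a + b = series fun i : Bool => bif i then a else b := by
    intro a b
    ext s
    simp [coeff_series]
  rw [h g g', hF, h]
  congr 1
  funext i
  cases i <;> rfl

theorem mono (hF : IsSigmaAdditive F) : Monotone F := by
  intro g g' h
  let d : MvPowerSeries V ℝ≥0∞ := fun s => coeff s g' - coeff s g
  have hg : g' = g + d :=
    MvPowerSeries.ext fun s => (add_tsub_cancel_of_le (le_iff_coeff.1 h s)).symm
  rw [hg, hF.map_add]
  exact fun s => le_self_add

theorem comp (hF : IsSigmaAdditive F) (hF' : IsSigmaAdditive F') :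
    IsSigmaAdditive fun g => F (F' g) := fun ι f => by
  simp only [hF' ι, hF ι]

theorem add (hF : IsSigmaAdditive F) (hF' : IsSigmaAdditive F') :
    IsSigmaAdditive fun g => F g + F' g := fun ι f => by
  ext s
  simp only [hF ι, hF' ι, _root_.map_add, coeff_series, ENNReal.tsum_add]

theorem iterate (hF : IsSigmaAdditive F) (k : ℕ) : IsSigmaAdditive F^[k] := by
  induction k with
  | zero => exact fun _ _ => rfl
  | succ k ih => exact ih.comp hF

/-- Geometric sums `g ↦ ∑ₖ Fᵏ g` of a countably additive map are countably additive. -/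
theorem series_iterate (hF : IsSigmaAdditive F) :
    IsSigmaAdditive fun g => series fun k => F^[k] g := fun ι f => by
  ext s
  simp only [hF.iterate _ ι, coeff_series]
  exact ENNReal.tsum_comm

end IsSigmaAdditive

/-- The least solution of `i = g + F i` is the geometric sum `∑ₖ Fᵏ g`. -/
theorem IsSigmaAdditive.lfp_eq {F : MvPowerSeries V ℝ≥0∞ → MvPowerSeries V ℝ≥0∞}
    (hF : IsSigmaAdditive F) (g : MvPowerSeries V ℝ≥0∞)
    (φ : MvPowerSeries V ℝ≥0∞ →o MvPowerSeries V ℝ≥0∞) (hφ : ∀ i, φ i = g + F i) :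
    OrderHom.lfp φ = series fun k => F^[k] g := by
  apply le_antisymm
  · refine OrderHom.lfp_le _ (le_of_eq ?_)
    rw [hφ, hF, series_nat fun k => F^[k] g]
    simp only [Function.iterate_succ_apply', Function.iterate_zero, id]
  · refine OrderHom.le_lfp _ fun i hi => ?_
    rw [hφ] at hi
    -- `N`-fold substitution of `g + F i ≤ i` into itself.
    have hpartial : ∀ N, ∑ k ∈ Finset.range N, F^[k] g + F^[N] i ≤ i := by
      intro N
      induction N with
      | zero => simp
      | succ N ih =>
        refine le_trans (le_trans (le_of_eq ?_) (add_mono le_rfl ((hF.iterate N).mono hi))) ih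
        rw [(hF.iterate N).map_add, Finset.sum_range_succ, add_assoc, Function.iterate_succ_apply]
    refine le_iff_coeff.2 fun s => ENNReal.tsum_le_of_sum_range_le fun N => ?_
    rw [← _root_.map_sum]
    exact (le_add_right le_rfl).trans
      ((_root_.map_add (coeff s) _ _).ge.trans (le_iff_coeff.1 (hpartial N) s))

theorem isSigmaAdditive_mul_right (h : MvPowerSeries V ℝ≥0∞) :
    IsSigmaAdditive fun g => g * h := fun ι f => by
  classical
  ext s
  simp only [coeff_mul, coeff_series, ← ENNReal.tsum_mul_right]
  exact (Summable.tsum_finsetSum fun _ _ => ENNReal.summable).symm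

theorem isSigmaAdditive_shift (v : V) : IsSigmaAdditive (shift v) := fun _ _ => rfl

section

variable [DecidableEq V]

theorem isSigmaAdditive_subst (v : V) (h : MvPowerSeries V ℝ≥0∞) :
    IsSigmaAdditive (subst v h) := fun ι f => by
  ext s
  change ∑ p ∈ _, ∑' k : ℕ, _ = ∑' i, ∑ p ∈ _, ∑' k : ℕ, _
  rw [Summable.tsum_finsetSum fun _ _ => ENNReal.summable]
  refine Finset.sum_congr rfl fun p _ => ?_
  simp only [coeff_series, ← ENNReal.tsum_mul_right]
  exact ENNReal.tsum_comm

theorem isSigmaAdditive_restrict (v : V) (n : ℕ) : IsSigmaAdditive (restrict v n) :=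
  fun ι f => by
    ext s
    simp only [coeff_restrict, coeff_series]
    split_ifs <;> simp

theorem isSigmaAdditive_restrictCompl (v : V) (n : ℕ) : IsSigmaAdditive (restrictCompl v n) :=
  fun ι f => by
    ext s
    simp only [coeff_restrictCompl, coeff_series]
    split_ifs <;> simp

/-! ### Loops as geometric sums -/

/-- One pass through a loop with guard `v < n` and body `P`: the states in which the guard holds
are sent through the body, the others are dropped. -/
noncomputable def pass (v : V) (n : ℕ) (P : ReDiP V) (g : MvPowerSeries V ℝ≥0∞) :
    MvPowerSeries V ℝ≥0∞ := pm P (restrict v n g)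

theorem pm_loop_apply {P : ReDiP V} (hP : IsSigmaAdditive (pm P)) (v : V) (n : ℕ)
    (g : MvPowerSeries V ℝ≥0∞) :
    pm (loop v n P) g = restrictCompl v n (series fun k => (pass v n P)^[k] g) :=
  congrArg (restrictCompl v n)
    ((hP.comp (isSigmaAdditive_restrict v n)).lfp_eq g _ fun _ => rfl)

theorem isSigmaAdditive_pm (P : ReDiP V) : IsSigmaAdditive (pm P) := by
  induction P with
  | assign v n =>
    exact (isSigmaAdditive_mul_right (X v ^ n)).comp (isSigmaAdditive_subst v 1)
  | decr v =>
    exact ((isSigmaAdditive_shift v).comp (isSigmaAdditive_restrictCompl v 1)).add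
      (isSigmaAdditive_restrict v 1)
  | incr v D y => exact isSigmaAdditive_subst y _
  | ite v n P₁ P₂ h₁ h₂ =>
    exact (h₁.comp (isSigmaAdditive_restrict v n)).add (h₂.comp (isSigmaAdditive_restrictCompl v n))
  | seq P₁ P₂ h₁ h₂ => exact h₂.comp h₁
  | loop v n P h =>
    rw [funext (pm_loop_apply h v n)]
    exact (isSigmaAdditive_restrictCompl v n).comp
      (h.comp (isSigmaAdditive_restrict v n)).series_iterate

theorem pm_loop (v : V) (n : ℕ) (P : ReDiP V) (g : MvPowerSeries V ℝ≥0∞) :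
    pm (loop v n P) g = series fun k => restrictCompl v n ((pass v n P)^[k] g) := by
  rw [pm_loop_apply (isSigmaAdditive_pm P), isSigmaAdditive_restrictCompl v n]

/-- Unrolling a loop once; on PGFs this is the fixed point equation for `Φ`. -/
theorem pm_loop_unroll (v : V) (n : ℕ) (P : ReDiP V) (g : MvPowerSeries V ℝ≥0∞) :
    pm (loop v n P) g = restrictCompl v n g + pm (loop v n P) (pm P (restrict v n g)) := by
  rw [pm_loop, pm_loop, series_nat]
  rfl

/-- Programs do not create mass. -/
theorem mass_pm_le (P : ReDiP V) (g : MvPowerSeries V ℝ≥0∞) : mass (pm P g) ≤ mass g := by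
  induction P generalizing g with
  | assign v n =>
    change mass (subst v 1 g * X v ^ n) ≤ mass g
    rw [mass_mul, mass_pow, mass_X, one_pow, mul_one]
    exact mass_subst_le v mass_one.le g
  | decr v =>
    change mass (shift v (restrictCompl v 1 g) + restrict v 1 g) ≤ mass g
    rw [mass_add, add_comm, ← mass_restrict_add_mass_restrictCompl v 1 g]
    exact add_le_add le_rfl (mass_shift_le v _)
  | incr v D y =>
    refine mass_subst_le y ?_ g
    rw [mass_mul, mass_X, mass_inVar_pmfSeries, one_mul]
  | ite v n P₁ P₂ h₁ h₂ =>
    change mass (pm P₁ _ + pm P₂ _) ≤ mass g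
    rw [mass_add, ← mass_restrict_add_mass_restrictCompl v n g]
    exact add_le_add (h₁ _) (h₂ _)
  | seq P₁ P₂ h₁ h₂ => exact (h₂ _).trans (h₁ g)
  | loop v n P h =>
    rw [pm_loop, mass_series]
    -- The mass that has left the loop after `N` passes and the mass still inside.
    have hpartial : ∀ N, ∑ k ∈ Finset.range N, mass (restrictCompl v n ((pass v n P)^[k] g)) +
        mass ((pass v n P)^[N] g) ≤ mass g := by
      intro N
      induction N with
      | zero => simp
      | succ N ih =>
        refine le_trans ?_ ih
        rw [Finset.sum_range_succ, add_assoc, Function.iterate_succ_apply',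
          ← mass_restrict_add_mass_restrictCompl v n ((pass v n P)^[N] g), add_comm (mass _)]
        exact add_le_add le_rfl (add_le_add (h _) le_rfl)
    exact ENNReal.tsum_le_of_sum_range_le fun N => le_self_add.trans (hpartial N)

end

/-! ### Passing to real coefficients -/

/-- The real series with the same coefficients; meaningful where these are finite. -/
noncomputable def toRealSeries (g : MvPowerSeries V ℝ≥0∞) : MvPowerSeries V ℝ :=
  fun s => (coeff s g).toReal

theorem coeff_toRealSeries (g : MvPowerSeries V ℝ≥0∞) (s : V →₀ ℕ) :
    coeff s (toRealSeries g) = (coeff s g).toReal := rfl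

theorem isPGF_toRealSeries {g : MvPowerSeries V ℝ≥0∞} (hg : mass g ≤ 1) :
    IsPGF (toRealSeries g) := by
  refine ⟨fun s => ENNReal.toReal_nonneg,
    ENNReal.summable_toReal (hg.trans_lt ENNReal.one_lt_top).ne, ?_⟩
  simp only [coeff_toRealSeries]
  rw [← ENNReal.tsum_toReal_eq (coeff_ne_top hg)]
  exact ENNReal.toReal_le_of_le_ofReal zero_le_one (hg.trans_eq ENNReal.ofReal_one.symm)

/-- The PGF given by a series of mass at most `1`. -/
noncomputable def pgf (g : MvPowerSeries V ℝ≥0∞) (hg : mass g ≤ 1) : PGF V :=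
  ⟨toRealSeries g, isPGF_toRealSeries hg⟩

theorem val_pgf {g : MvPowerSeries V ℝ≥0∞} (hg : mass g ≤ 1) :
    (pgf g hg).1 = toRealSeries g := rfl

theorem toPGF_toRealSeries {g : MvPowerSeries V ℝ≥0∞} (hg : mass g ≤ 1) :
    toPGF (toRealSeries g) = Part.some (pgf g hg) :=
  Part.ext' (iff_of_true (isPGF_toRealSeries hg) trivial) fun _ _ => rfl

/-- The series with extended coefficients that underlies a PGF. -/
noncomputable def PGF.toENNReal (G : PGF V) : MvPowerSeries V ℝ≥0∞ :=
  fun s => ENNReal.ofReal (coeff s G.1)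

theorem PGF.mass_toENNReal_le (G : PGF V) : mass G.toENNReal ≤ 1 := by
  obtain ⟨G, h0, hs, h1⟩ := G
  change ∑' s, ENNReal.ofReal (coeff s G) ≤ 1
  rw [← ENNReal.ofReal_tsum_of_nonneg h0 hs]
  exact ENNReal.ofReal_le_one.2 h1

theorem PGF.toRealSeries_toENNReal (G : PGF V) : toRealSeries G.toENNReal = G.1 :=
  MvPowerSeries.ext fun s => ENNReal.toReal_ofReal (G.2.1 s)

theorem PGF.exists_eq_pgf (G : PGF V) : ∃ g hg, G = pgf g hg :=
  ⟨G.toENNReal, G.mass_toENNReal_le, Subtype.ext G.toRealSeries_toENNReal.symm⟩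

theorem pgf_congr {g g' : MvPowerSeries V ℝ≥0∞} (h : g = g') (hg : mass g ≤ 1)
    (hg' : mass g' ≤ 1) : pgf g hg = pgf g' hg' := by
  subst h
  rfl

theorem pgf_le_pgf {g g' : MvPowerSeries V ℝ≥0∞} (hg : mass g ≤ 1) (hg' : mass g' ≤ 1) :
    pgf g hg ≤ pgf g' hg' ↔ g ≤ g' :=
  forall_congr' fun s => ENNReal.toReal_le_toReal (coeff_ne_top hg s) (coeff_ne_top hg' s)

theorem toENNReal_pgf {g : MvPowerSeries V ℝ≥0∞} (hg : mass g ≤ 1) : (pgf g hg).toENNReal = g :=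
  MvPowerSeries.ext fun s => ENNReal.ofReal_toReal (coeff_ne_top hg s)

theorem toRealSeries_add {g h : MvPowerSeries V ℝ≥0∞} (hg : mass g ≤ 1) (hh : mass h ≤ 1) :
    toRealSeries (g + h) = toRealSeries g + toRealSeries h := by
  ext s
  simp only [map_add, coeff_toRealSeries]
  exact ENNReal.toReal_add (coeff_ne_top hg s) (coeff_ne_top hh s)

theorem toRealSeries_monomial (s : V →₀ ℕ) :
    toRealSeries (monomial s 1) = (monomial s 1 : MvPowerSeries V ℝ) := by
  classical
  ext t
  rw [coeff_toRealSeries, coeff_monomial, coeff_monomial]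
  split_ifs <;> simp

theorem toRealSeries_one : toRealSeries (1 : MvPowerSeries V ℝ≥0∞) = 1 :=
  toRealSeries_monomial 0

theorem toRealSeries_mul {g h : MvPowerSeries V ℝ≥0∞} (hg : mass g ≤ 1) (hh : mass h ≤ 1) :
    toRealSeries (g * h) = toRealSeries g * toRealSeries h := by
  classical
  ext s
  simp only [coeff_toRealSeries, coeff_mul]
  rw [ENNReal.toReal_sum fun p _ =>
    ENNReal.mul_ne_top (coeff_ne_top hg _) (coeff_ne_top hh _)]
  simp only [ENNReal.toReal_mul]

theorem mass_pow_le_one {g : MvPowerSeries V ℝ≥0∞} (hg : mass g ≤ 1) (k : ℕ) :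
    mass (g ^ k) ≤ 1 := by
  rw [mass_pow]
  exact pow_le_one₀ zero_le hg

theorem toRealSeries_pow {g : MvPowerSeries V ℝ≥0∞} (hg : mass g ≤ 1) (k : ℕ) :
    toRealSeries (g ^ k) = toRealSeries g ^ k := by
  induction k with
  | zero => simp [toRealSeries_one]
  | succ k ih => rw [pow_succ, pow_succ, toRealSeries_mul (mass_pow_le_one hg k) hg, ih]

theorem toRealSeries_inVar_pmfSeries (v : V) (D : PMF ℕ) :
    toRealSeries (inVar v (pmfSeries D)) = inVar v (pmfSeriesReal D) := by
  classical
  ext s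
  rw [coeff_toRealSeries, coeff_inVar, coeff_inVar]
  split_ifs <;> simp [pmfSeries, pmfSeriesReal]

theorem toRealSeries_shift (v : V) (g : MvPowerSeries V ℝ≥0∞) :
    toRealSeries (shift v g) = shift v (toRealSeries g) := rfl

theorem coeff_pderiv_iterate_real (v : V) (i : ℕ) (g : MvPowerSeries V ℝ) (s : V →₀ ℕ)
    (hs : s v = 0) : coeff s ((pderiv ℝ v)^[i] g) =
      coeff (s + Finsupp.single v i) g * (i.factorial : ℝ) := by
  induction i generalizing g with
  | zero => simp
  | succ i ih =>
    rw [Function.iterate_succ_apply, ih, coeff_pderiv, add_assoc, ← Finsupp.single_add,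
      Nat.factorial_succ]
    simp only [Finsupp.add_apply, hs, Finsupp.single_eq_same, zero_add]
    push_cast
    ring

section

variable [DecidableEq V]

theorem toRealSeries_subst (v : V) {g h : MvPowerSeries V ℝ≥0∞} (hg : mass g ≤ 1)
    (hh : mass h ≤ 1) :
    toRealSeries (subst v h g) = subst v (toRealSeries h) (toRealSeries g) := by
  have hfin : ∀ s, coeff s (subst v h g) ≠ ∞ := coeff_ne_top ((mass_subst_le v hh g).trans hg)
  ext s
  change ENNReal.toReal (∑ p ∈ _, ∑' k : ℕ, _) = ∑ p ∈ _, ∑' k : ℕ, _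
  rw [ENNReal.toReal_sum fun p hp => ENNReal.sum_ne_top.1 (hfin s) p hp]
  refine Finset.sum_congr rfl fun p _ => ?_
  rw [ENNReal.tsum_toReal_eq fun k => ENNReal.mul_ne_top (coeff_ne_top hg _)
    (coeff_ne_top (mass_pow_le_one hh k) _)]
  simp only [ENNReal.toReal_mul, ← toRealSeries_pow hh, coeff_toRealSeries]

theorem coeff_subst_zero_real (v : V) (g : MvPowerSeries V ℝ) (s : V →₀ ℕ) :
    coeff s (subst v 0 g) = if s v = 0 then coeff s g else 0 := by
  have key : ∀ p : (V →₀ ℕ) × (V →₀ ℕ),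
      ∑' k : ℕ, coeff (p.1.update v k) g * coeff p.2 ((0 : MvPowerSeries V ℝ) ^ k) =
      if p.2 = 0 then coeff (p.1.update v 0) g else 0 := by
    intro p
    rw [tsum_eq_single 0]
    · simp [coeff_one]
    · intro k hk
      simp [hk]
  change ∑ p ∈ _, _ = _
  rw [Finset.sum_congr rfl fun p _ => key p]
  split_ifs with h
  · rw [Finset.sum_eq_single (s, 0)]
    · have : s.update v 0 = s := by rw [← h, Finsupp.update_self]
      simp [this]
    · rintro ⟨a, b⟩ hp hne
      simp only [Finset.mem_filter, Finset.HasAntidiagonal.mem_antidiagonal] at hp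
      rw [if_neg]
      rintro rfl
      exact hne (by simpa using hp.1)
    · intro hn
      simp [h] at hn
  · refine Finset.sum_eq_zero fun p hp => if_neg fun h0 => h ?_
    rw [← (Finset.mem_filter.1 hp).2, h0]
    rfl

theorem coeff_restrict_real (v : V) (n : ℕ) (g : MvPowerSeries V ℝ) (s : V →₀ ℕ) :
    coeff s (restrict v n g) = if s v < n then coeff s g else 0 := by
  have key : ∀ i : ℕ, coeff s (C ((i.factorial : ℝ)⁻¹) *
      subst v 0 ((pderiv ℝ v)^[i] g) * X v ^ i) = if i = s v then coeff s g else 0 := by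
    intro i
    rw [X_pow_eq, coeff_mul_monomial, mul_one]
    by_cases h : Finsupp.single v i ≤ s
    · rw [if_pos h, coeff_C_mul, coeff_subst_zero_real]
      have hi : i ≤ s v := by simpa using h v
      have hv : (s - Finsupp.single v i) v = s v - i := by simp
      rw [hv]
      by_cases h2 : i = s v
      · rw [if_pos h2, if_pos (by omega), coeff_pderiv_iterate_real _ _ _ _ (by rw [hv]; omega),
          tsub_add_cancel_of_le h, mul_comm, mul_assoc, mul_inv_cancel₀, mul_one]
        exact_mod_cast i.factorial_ne_zero
      · rw [if_neg h2, if_neg (by omega), mul_zero]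
    · rw [if_neg h, if_neg]
      rintro rfl
      exact h (by simp)
  rw [restrict, map_sum, Finset.sum_congr rfl fun i _ => key i, Finset.sum_ite_eq']
  simp

theorem restrict_toRealSeries (v : V) (n : ℕ) (g : MvPowerSeries V ℝ≥0∞) :
    restrict v n (toRealSeries g) = toRealSeries (restrict v n g) := by
  ext s
  simp only [coeff_restrict_real, coeff_toRealSeries, coeff_restrict]
  split_ifs <;> simp

theorem subst_zero_toRealSeries (v : V) (g : MvPowerSeries V ℝ≥0∞) :
    subst v 0 (toRealSeries g) = toRealSeries (restrict v 1 g) := by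
  ext s
  simp only [coeff_subst_zero_real, coeff_toRealSeries, coeff_restrict, Nat.lt_one_iff]
  split_ifs <;> simp

theorem toRealSeries_sub_restrict (v : V) (n : ℕ) (g : MvPowerSeries V ℝ≥0∞) :
    toRealSeries g - toRealSeries (restrict v n g) = toRealSeries (restrictCompl v n g) := by
  ext s
  simp only [map_sub, coeff_toRealSeries, coeff_restrict, coeff_restrictCompl]
  split_ifs <;> simp

/-! ### Agreement of the two semantics -/

/-- `pm⟦P⟧` as a map on PGFs. -/
noncomputable def pmPGF (P : ReDiP V) (G : PGF V) : PGF V :=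
  pgf (pm P G.toENNReal) ((mass_pm_le P _).trans G.mass_toENNReal_le)

theorem pmPGF_pgf (P : ReDiP V) {g : MvPowerSeries V ℝ≥0∞} (hg : mass g ≤ 1) :
    pmPGF P (pgf g hg) = pgf (pm P g) ((mass_pm_le P g).trans hg) :=
  pgf_congr (by rw [toENNReal_pgf]) _ _

theorem mass_pass_le (v : V) (n : ℕ) (P : ReDiP V) (g : MvPowerSeries V ℝ≥0∞) :
    mass (pass v n P g) ≤ mass g :=
  (mass_pm_le P _).trans (mass_restrict_le v n g)

theorem unfolding_eq_bind (v : V) (n : ℕ) (F : PGF V → Part (PGF V)) (T : PGF V → PGF V)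
    (G : PGF V) : unfolding v n F T G = (toPGF (restrict v n G.1)).bind fun A =>
      (F A).bind fun B => toPGF ((G.1 - restrict v n G.1) + (T B).1) := rfl

theorem chen_ite_eq_bind (v : V) (n : ℕ) (P₁ P₂ : ReDiP V) (G : PGF V) :
    chen (ite v n P₁ P₂) G = (toPGF (restrict v n G.1)).bind fun A =>
      (toPGF (G.1 - restrict v n G.1)).bind fun B => (chen P₁ A).bind fun A' =>
        (chen P₂ B).bind fun B' => toPGF (A'.1 + B'.1) := rfl

/-- The unfolding operator of a loop, if the two semantics agree on its body. -/
theorem unfolding_pgf {v : V} {n : ℕ} {P : ReDiP V}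
    (hP : ∀ G, chen P G = Part.some (pmPGF P G)) (T : PGF V → PGF V)
    {g : MvPowerSeries V ℝ≥0∞} (hg : mass g ≤ 1) :
    unfolding v n (chen P) T (pgf g hg) = toPGF (toRealSeries (restrictCompl v n g) +
      (T (pgf (pass v n P g) ((mass_pass_le v n P g).trans hg))).1) := by
  have hr : mass (restrict v n g) ≤ 1 := (mass_restrict_le v n g).trans hg
  rw [unfolding_eq_bind, val_pgf, restrict_toRealSeries, toPGF_toRealSeries hr, Part.bind_some, hP,
    Part.bind_some, pmPGF_pgf, toRealSeries_sub_restrict]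
  rfl

theorem isLoopLfp_pmPGF {P : ReDiP V} (hP : ∀ G, chen P G = Part.some (pmPGF P G))
    (v : V) (n : ℕ) : IsLoopLfp v n (chen P) (pmPGF (loop v n P)) := by
  constructor
  · intro G
    obtain ⟨g, hg, rfl⟩ := G.exists_eq_pgf
    have hp : mass (pass v n P g) ≤ 1 := (mass_pass_le v n P g).trans hg
    rw [unfolding_pgf hP, pmPGF_pgf, pmPGF_pgf]
    change toPGF (_ + toRealSeries _) = _
    rw [← toRealSeries_add ((mass_restrictCompl_le v n g).trans hg) ((mass_pm_le _ _).trans hp),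
      ← toPGF_toRealSeries]
    exact congrArg (fun h => toPGF (toRealSeries h)) (pm_loop_unroll v n P g).symm
  · intro T hT
    -- Every solution dominates the mass that leaves the loop within `N` passes.
    have hpartial : ∀ (N : ℕ) (g : MvPowerSeries V ℝ≥0∞) (hg : mass g ≤ 1),
        ∑ k ∈ Finset.range N, restrictCompl v n ((pass v n P)^[k] g) ≤
          (T (pgf g hg)).toENNReal := by
      intro N
      induction N with
      | zero => exact fun g hg s => zero_le
      | succ N ih =>
        intro g hg
        have hp : mass (pass v n P g) ≤ 1 := (mass_pass_le v n P g).trans hg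
        have hTg := hT (pgf g hg)
        rw [unfolding_pgf hP] at hTg
        obtain ⟨_, hval⟩ := Part.eq_some_iff.1 hTg
        have hsum : (T (pgf g hg)).toENNReal =
            restrictCompl v n g + (T (pgf (pass v n P g) hp)).toENNReal := by
          ext s
          have hs := congrArg (fun G : PGF V => ENNReal.ofReal (coeff s G.1)) hval
          refine hs.symm.trans ?_
          change ENNReal.ofReal (coeff s (_ + _)) = _
          rw [map_add, map_add]
          refine (ENNReal.ofReal_add ENNReal.toReal_nonneg ((T _).2.1 s)).trans ?_
          refine congrArg (· + _) ?_
          exact ENNReal.ofReal_toReal (coeff_ne_top ((mass_restrictCompl_le v n g).trans hg) s)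
        rw [hsum, Finset.sum_range_succ', add_comm]
        exact add_mono le_rfl (ih _ hp)
    intro G
    obtain ⟨g, hg, rfl⟩ := G.exists_eq_pgf
    obtain ⟨t, ht, hTt⟩ := (T (pgf g hg)).exists_eq_pgf
    rw [pmPGF_pgf, hTt, pgf_le_pgf, pm_loop]
    refine le_iff_coeff.2 fun s => ENNReal.tsum_le_of_sum_range_le fun N => ?_
    have hN := hpartial N g hg
    rw [hTt, toENNReal_pgf] at hN
    rw [← map_sum]
    exact le_iff_coeff.1 hN s

/-- The semantics of Chen et al. is defined on every PGF and agrees with `pm⟦P⟧` there. -/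
theorem chen_eq_some_pmPGF (P : ReDiP V) (G : PGF V) : chen P G = Part.some (pmPGF P G) := by
  induction P generalizing G with
  | assign v n =>
    obtain ⟨g, hg, rfl⟩ := G.exists_eq_pgf
    have hX : mass (X v ^ n : MvPowerSeries V ℝ≥0∞) ≤ 1 := mass_pow_le_one (mass_X v).le n
    rw [pmPGF_pgf, ← toPGF_toRealSeries]
    change toPGF (subst v 1 (toRealSeries g) * X v ^ n) =
      toPGF (toRealSeries (subst v 1 g * X v ^ n))
    rw [toRealSeries_mul ((mass_subst_le v mass_one.le g).trans hg) hX,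
      toRealSeries_subst v hg mass_one.le, toRealSeries_one, toRealSeries_pow (mass_X v).le]
    exact congrArg (fun x => toPGF (_ * x ^ n)) (toRealSeries_monomial _).symm
  | decr v =>
    obtain ⟨g, hg, rfl⟩ := G.exists_eq_pgf
    rw [pmPGF_pgf, ← toPGF_toRealSeries]
    change toPGF (shift v (toRealSeries g - subst v 0 (toRealSeries g)) +
      subst v 0 (toRealSeries g)) =
        toPGF (toRealSeries (shift v (restrictCompl v 1 g) + restrict v 1 g))
    rw [toRealSeries_add (((mass_shift_le v _).trans (mass_restrictCompl_le v 1 g)).trans hg)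
      ((mass_restrict_le v 1 g).trans hg), subst_zero_toRealSeries, toRealSeries_sub_restrict,
      toRealSeries_shift]
  | incr v D y =>
    obtain ⟨g, hg, rfl⟩ := G.exists_eq_pgf
    have hD : mass (inVar v (pmfSeries D)) ≤ 1 := (mass_inVar_pmfSeries v D).le
    rw [pmPGF_pgf, ← toPGF_toRealSeries]
    change toPGF (subst y (X y * inVar v (pmfSeriesReal D)) (toRealSeries g)) =
      toPGF (toRealSeries (subst y (X y * inVar v (pmfSeries D)) g))
    rw [toRealSeries_subst y hg (by rw [mass_mul, mass_X, one_mul]; exact hD),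
      toRealSeries_mul (mass_X y).le hD, toRealSeries_inVar_pmfSeries]
    exact congrArg (fun x => toPGF (subst y (x * _) _)) (toRealSeries_monomial _).symm
  | ite v n P₁ P₂ h₁ h₂ =>
    obtain ⟨g, hg, rfl⟩ := G.exists_eq_pgf
    have hr : mass (restrict v n g) ≤ 1 := (mass_restrict_le v n g).trans hg
    have hc : mass (restrictCompl v n g) ≤ 1 := (mass_restrictCompl_le v n g).trans hg
    rw [pmPGF_pgf, ← toPGF_toRealSeries]
    rw [chen_ite_eq_bind, val_pgf, restrict_toRealSeries, toPGF_toRealSeries hr, Part.bind_some,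
      toRealSeries_sub_restrict, toPGF_toRealSeries hc, Part.bind_some, h₁, Part.bind_some, h₂,
      Part.bind_some, pmPGF_pgf, pmPGF_pgf, val_pgf, val_pgf,
      ← toRealSeries_add ((mass_pm_le _ _).trans hr) ((mass_pm_le _ _).trans hc)]
    rfl
  | seq P₁ P₂ h₁ h₂ =>
    obtain ⟨g, hg, rfl⟩ := G.exists_eq_pgf
    change (chen P₁ _).bind _ = _
    rw [h₁, Part.bind_some, h₂, pmPGF_pgf, pmPGF_pgf, pmPGF_pgf]
    rfl
  | loop v n P h =>
    -- `chen` chooses some least fixed point; it is unique.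
    have hlfp := isLoopLfp_pmPGF h v n
    refine Part.ext' (iff_of_true ⟨_, hlfp⟩ trivial) fun hex _ => ?_
    exact congrFun (hex.choose_spec.unique hlfp) G

end

theorem mass_gf_le [Finite V] (μ : MeasureTheory.Measure (V → ℕ)) : mass (gf μ) ≤ μ Set.univ := by
  calc mass (gf μ) ≤ ∑' x : V → ℕ, μ {x} :=
        ENNReal.tsum_comp_le_tsum_of_injective (f := fun s : V →₀ ℕ => ⇑s)
          DFunLike.coe_injective fun x => μ {x}
    _ ≤ μ (⋃ x, {x}) :=
        MeasureTheory.tsum_meas_le_meas_iUnion_of_disjoint μ MeasurableSet.singleton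
          fun _ _ => Set.disjoint_singleton.2
    _ ≤ μ Set.univ := MeasureTheory.measure_mono (Set.subset_univ _)

end ReDiP

theorem mainTheorem10 {V : Type*} [Fintype V] [DecidableEq V]
    (μ : MeasureTheory.Measure (V → ℕ)) (hμ : μ Set.univ ≤ 1) (P : ReDiP V) :
    ∃ g : MvPowerSeries V ℝ≥0,
      MvPowerSeries.map ENNReal.ofNNRealHom g = ReDiP.gf μ ∧
      ∃ G H : ReDiP.PGF V,
        G.1 = MvPowerSeries.map NNReal.toRealHom g ∧
        H ∈ ReDiP.chen P G ∧
        ∀ s, MvPowerSeries.coeff s (ReDiP.pm P (ReDiP.gf μ)) =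
          ENNReal.ofReal (MvPowerSeries.coeff s H.1) := by
  have hg : ReDiP.mass (ReDiP.gf μ) ≤ 1 := (ReDiP.mass_gf_le μ).trans hμ
  have hpm : ReDiP.mass (ReDiP.pm P (ReDiP.gf μ)) ≤ 1 := (ReDiP.mass_pm_le P _).trans hg
  refine ⟨fun s => (MvPowerSeries.coeff s (ReDiP.gf μ)).toNNReal,
    MvPowerSeries.ext fun s => ENNReal.coe_toNNReal (ReDiP.coeff_ne_top hg s),
    ReDiP.pgf (ReDiP.gf μ) hg, ReDiP.pgf (ReDiP.pm P (ReDiP.gf μ)) hpm, rfl, ?_,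
    fun s => (ENNReal.ofReal_toReal (ReDiP.coeff_ne_top hpm s)).symm⟩
  rw [ReDiP.chen_eq_some_pmPGF, ReDiP.pmPGF_pgf]
  exact Part.mem_some _
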